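/- For a finite nonempty set $X$ and a map $f:X\to X$, let $\deg(f)=\frac{1}{|X|}\sum_{x\in X}|f^{-1}(f(x))|$ be its degree of noninvertibility. Let $\mathrm{Comp}(n)$ be the set of compositions of $n$, and let $\mathscr C:\mathrm{Comp}(n)\to\mathrm{Comp}(n)$ be the Carolina solitaire map, which sends $c=(c_1,\ldots,c_\ell)$ to the composition obtained by deleting all of the $0$'s from the tuple $(\ell,c_1-1,\ldots,c_\ell-1)$. There is a unique sequence of integers $(\eta_n)_{n\ge 0}$ such that, as formal power series, \[\sum_{n\geq 0}\eta_nx^n=\frac{1-x}{\sqrt{1-4x+4x^2-4x^3+4x^4}},\] where the square root is the one with constant term $1$. For this sequence, \[\deg(\mathscr C:\mathrm{Comp}(n)\to\mathrm{Comp}(n))=\frac{\eta_n}{2^{n-1}}\qquad\text{for all } n\geq 1.\] Moreover, the polynomial $1-4x+4x^2-4x^3+4x^4$ has a smallest positive real root $\rho$, where $\rho\approx 0.33933$ (to five decimal places), and, as $n\to\infty$, \[\deg(\mathscr C:\mathrm{Comp}(n)\to\mathrm{Comp}(n))\sim\frac{1-\rho}{\sqrt{\pi(1-3\rho+2\rho^2-\rho^3)n}}\left(\frac{1}{2\rho}\right)^n.\]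 -/

import Mathlib

/-- The degree of noninjectivity `(1/|X|) ∑ x, |f⁻¹(f(x))|` of a map `f` on a finite set `X`;
for an endofunction it is the degree of noninvertibility. -/
noncomputable def degNoninj {α β : Type*} [Fintype α] (f : α → β) : ℝ :=
  (1 / (Fintype.card α : ℝ)) * ∑ x : α, ((f ⁻¹' {f x}).ncard : ℝ)

/-- The list obtained from `(ℓ, c₁ - 1, …, c_ℓ - 1)` by deleting all zeros, for
`l = (c₁, …, c_ℓ)`. -/
def carolinaList (l : List ℕ) : List ℕ :=
  (l.length :: l.map (fun a => a - 1)).filter (fun a => a ≠ 0)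

theorem sum_filter_ne_zero_list (l : List ℕ) : (l.filter (fun a => a ≠ 0)).sum = l.sum := by
  induction l with
  | nil => rfl
  | cons a t ih =>
    by_cases h : a = 0
    · simpa [h] using ih
    · simpa [h] using ih

theorem length_add_sum_map_pred (l : List ℕ) (h : ∀ a ∈ l, 0 < a) :
    l.length + (l.map (fun a => a - 1)).sum = l.sum := by
  induction l with
  | nil => rfl
  | cons a t ih =>
    have h1 := ih (fun b hb => h b (List.mem_cons_of_mem _ hb))
    have h2 := h a List.mem_cons_self
    simp only [List.length_cons, List.map_cons, List.sum_cons]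
    omega

/-- The Carolina solitaire map on compositions of `n`. -/
def carolina {n : ℕ} (c : Composition n) : Composition n where
  blocks := carolinaList c.blocks
  blocks_pos := by
    intro i hi
    have h := (List.mem_filter.mp hi).2
    exact Nat.pos_of_ne_zero (by simpa using h)
  blocks_sum := by
    unfold carolinaList
    rw [sum_filter_ne_zero_list, List.sum_cons,
      length_add_sum_map_pred c.blocks (fun _ ha => c.blocks_pos ha), c.blocks_sum]

/-- The formal power series `S` is the square root (with constant term `1`) of `Q`. -/
def IsFormalSqrt (S Q : PowerSeries ℚ) : Prop :=
  S ^ 2 = Q ∧ PowerSeries.constantCoeff S = 1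

/-- `∑ η_n x^n = (1 - x) / √(1 - 4x + 4x² - 4x³ + 4x⁴)` as formal power series. -/
def HasCarolinaGF (η : ℕ → ℤ) : Prop :=
  ∃ S : PowerSeries ℚ,
    IsFormalSqrt S (1 - 4 * PowerSeries.X + 4 * PowerSeries.X ^ 2 - 4 * PowerSeries.X ^ 3
      + 4 * PowerSeries.X ^ 4) ∧
    PowerSeries.mk (fun n => (η n : ℚ)) = (1 - PowerSeries.X) * S⁻¹

/-! ### Formal power series -/

/-! A preimage of `(l, e)` has `l` blocks; lowering each by one gives a list of length `l` whose
nonzero part is `e`, so the fibre has `l.choose e.length` elements (`ncard_carolina_fiber`). The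
degree is thus `2 ^ (1 - n)` times the sum of the squares of these numbers, `carolinaPairs n`.

Compositions with `k` parts have generating function `y ^ k`, `y = x / (1 - x)`. Hence that of
`carolinaPairs` is `∑ l k, (l choose k)² y ^ k t ^ l` at `t = x`. This Legendre-type series equals
`(1 - 2(1 + y)t + (1 - y)²t²) ^ (-1/2)` (`chooseSq_genFun`), and clearing `(1 - x)²` produces the
quartic. Square roots are avoided throughout by working with identities `P² D = 1`.

For the asymptotics, write the quartic as `(1 - x/ρ) R` with `R` cubic. The generating function is
then `G * B`, where `B = (1 - x/ρ) ^ (-1/2)` has central binomial coefficients and `G = (1 - x) R ^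
(-1/2)` has coefficients `O(2 ^ n)`. Since `2ρ < 1`, dominated convergence gives coefficients
asymptotic to `G(ρ)` times those of `B` (`tendsto_conv_invSqrtCoeff`), and Wallis' product supplies
the `√(πn)`. -/

theorem PowerSeries.sq_mul_eq_one_of_derivative {R : Type*} [CommRing R] [IsAddTorsionFree R]
    {P D : PowerSeries R}
    (h : 2 * D * PowerSeries.derivative R P + PowerSeries.derivative R D * P = 0)
    (h0 : PowerSeries.constantCoeff (P ^ 2 * D) = 1) : P ^ 2 * D = 1 := by
  -- The derivative of `P² D` is `P (2 D P' + D' P) = 0`, and without additive torsion a series is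
  -- determined by its derivative and constant term.
  apply PowerSeries.derivative.ext
  · rw [Derivation.leibniz, Derivation.leibniz_pow, Derivation.map_one_eq_zero]
    simp only [smul_eq_mul, nsmul_eq_mul]
    push_cast
    linear_combination P * h
  · rw [h0, map_one]

/-! ### Legendre recurrence for squares of binomial coefficients -/

theorem Nat.cast_choose_succ_mul_rat (n k : ℕ) :
    (n.choose (k + 1) : ℚ) * (k + 1) = n.choose k * (n - k) := by
  rcases le_or_gt k n with h | h
  · rw [← Nat.cast_sub h]
    exact_mod_cast Nat.choose_succ_right_eq n k
  · rw [Nat.choose_eq_zero_of_lt h, Nat.choose_eq_zero_of_lt (by omega)]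
    simp

/-- After Pascal's rule, this is half of the `Y ^ (k + 2)` coefficient of the recurrence
`chooseSqPoly_rec`. -/
theorem Nat.choose_turan_identity (n k : ℕ) :
    (n.choose (k + 2) * n.choose (k + 1) + n.choose (k + 1) * n.choose k
      + (n + 2) * (n.choose (k + 2) * n.choose k) : ℚ) = n * n.choose (k + 1) ^ 2 := by
  have h1 := Nat.cast_choose_succ_mul_rat n (k + 1)
  have h2 := Nat.cast_choose_succ_mul_rat n k
  push_cast at h1
  set a : ℚ := (n.choose (k + 1 + 1) : ℚ)
  set b : ℚ := (n.choose (k + 1) : ℚ)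
  set c : ℚ := (n.choose k : ℚ)
  change a * b + b * c + (n + 2) * (a * c) = n * b ^ 2
  by_cases hnk : n = k
  · have hb : b = 0 := by simp [b, hnk]
    have ha : a = 0 := by simp [a, hnk, Nat.choose_eq_zero_of_lt]
    simp [ha, hb]
  · have hne : ((k : ℚ) + 2) * (n - k) ≠ 0 := by
      refine mul_ne_zero (by positivity) (sub_ne_zero.mpr (by exact_mod_cast hnk))
    apply mul_left_cancel₀ hne
    linear_combination ((n - k : ℚ) * b + (n + 2) * (n - k) * c) * h1
      - (b * (k + 2) + (n + 2) * (n - k - 1) * b) * h2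

/-- The polynomial `∑ k, (n choose k)² Y ^ k`. -/
noncomputable def chooseSqPoly (n : ℕ) : Polynomial ℚ :=
  ∑ k ∈ Finset.range (n + 1), Polynomial.C ((n.choose k : ℚ) ^ 2) * Polynomial.X ^ k

theorem coeff_chooseSqPoly (n k : ℕ) : (chooseSqPoly n).coeff k = (n.choose k : ℚ) ^ 2 := by
  simp only [chooseSqPoly, Polynomial.finsetSum_coeff, Polynomial.coeff_C_mul_X_pow]
  rw [Finset.sum_ite_eq]
  split_ifs with h
  · rfl
  · rw [Nat.choose_eq_zero_of_lt (by simpa using h)]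
    simp

/-- Bonnet's recurrence for Legendre polynomials, since `chooseSqPoly n` is `(1 - Y) ^ n P_n((1 + Y)
/ (1 - Y))`; here it is checked coefficientwise. -/
theorem chooseSqPoly_rec (n : ℕ) :
    ((n : Polynomial ℚ) + 2) * chooseSqPoly (n + 2) =
      (2 * (n : Polynomial ℚ) + 3) * ((1 + Polynomial.X) * chooseSqPoly (n + 1))
        - ((n : Polynomial ℚ) + 1) * ((1 - Polynomial.X) ^ 2 * chooseSqPoly n) := by
  have e : ∀ (q : ℚ) (p : Polynomial ℚ), Polynomial.C q * p = q • p :=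
    fun q p => (Polynomial.smul_eq_C_mul q).symm
  have h1 : ((n : Polynomial ℚ) + 2) = Polynomial.C ((n : ℚ) + 2) := by
    simp [map_ofNat]
  have h2 : (2 * (n : Polynomial ℚ) + 3) = Polynomial.C (2 * (n : ℚ) + 3) := by
    simp [map_ofNat]
  have h3 : ((n : Polynomial ℚ) + 1) = Polynomial.C ((n : ℚ) + 1) := by simp
  have h4 : (1 - Polynomial.X) ^ 2 * chooseSqPoly n = chooseSqPoly n
      - (Polynomial.X * chooseSqPoly n + Polynomial.X * chooseSqPoly n)
      + Polynomial.X * (Polynomial.X * chooseSqPoly n) := by ring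
  rw [h1, h2, h3, h4, add_mul 1 Polynomial.X, one_mul, e, e, e]
  ext k
  rcases k with _ | _ | k
  · simp [coeff_chooseSqPoly]
    ring
  · simp only [Polynomial.coeff_smul, Polynomial.coeff_sub, Polynomial.coeff_add,
      Polynomial.coeff_X_mul, coeff_chooseSqPoly, Polynomial.coeff_X_mul_zero, smul_eq_mul,
      zero_add, Nat.choose_one_right, Nat.choose_zero_right]
    push_cast
    ring
  · simp only [Polynomial.coeff_smul, Polynomial.coeff_sub, Polynomial.coeff_add,
      Polynomial.coeff_X_mul, coeff_chooseSqPoly, smul_eq_mul]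
    have h := Nat.choose_turan_identity n k
    rw [Nat.choose_succ_succ' (n + 1) (k + 1), Nat.choose_succ_succ' n (k + 1),
      Nat.choose_succ_succ' n k]
    push_cast
    linear_combination 2 * h

theorem PowerSeries.sq_mul_quadratic_eq_one {A : Type*} [CommRing A] [IsAddTorsionFree A]
    (u v : A) (p : ℕ → A) (h0 : p 0 = 1) (h1 : p 1 = u)
    (hrec : ∀ n : ℕ, ((n : A) + 2) * p (n + 2) =
      (2 * n + 3) * (u * p (n + 1)) - (n + 1) * (v * p n)) :
    PowerSeries.mk p ^ 2 * (1 - 2 * (PowerSeries.C u * PowerSeries.X)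
      + PowerSeries.C v * PowerSeries.X ^ 2) = 1 := by
  have hc : ∀ n, PowerSeries.coeff n (PowerSeries.mk p) = p n := fun n =>
    PowerSeries.coeff_mk n p
  set P : PowerSeries A := PowerSeries.mk p
  apply PowerSeries.sq_mul_eq_one_of_derivative
  · have hD : PowerSeries.derivative A (1 - 2 * (PowerSeries.C u * PowerSeries.X)
        + PowerSeries.C v * PowerSeries.X ^ 2) =
        - (2 * PowerSeries.C u) + 2 * (PowerSeries.C v * PowerSeries.X) := by
      rw [two_mul (PowerSeries.C u * PowerSeries.X)]
      simp only [map_add, map_sub, Derivation.leibniz, Derivation.leibniz_pow,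
        Derivation.map_one_eq_zero, PowerSeries.derivative_C, PowerSeries.derivative_X,
        smul_eq_mul]
      simp
      ring
    -- The recurrence is the coefficient form of `(1 - 2uX + vX²) P' = (u - vX) P`. The lowest
    -- coefficient needs only the initial values.
    have key : PowerSeries.derivative A P
        - (PowerSeries.C u * (PowerSeries.X * PowerSeries.derivative A P)
          + PowerSeries.C u * (PowerSeries.X * PowerSeries.derivative A P))
        + PowerSeries.C v * (PowerSeries.X * (PowerSeries.X * PowerSeries.derivative A P))
        - PowerSeries.C u * P + PowerSeries.C v * (PowerSeries.X * P) = 0 := by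
      ext n
      rcases n with _ | _ | n
      · simp only [map_add, map_sub, PowerSeries.coeff_C_mul, PowerSeries.coeff_zero_X_mul, hc,
          PowerSeries.coeff_derivative, map_zero]
        simp [h0, h1]
      · have := hrec 0
        simp only [map_add, map_sub, PowerSeries.coeff_C_mul, PowerSeries.coeff_zero_X_mul, hc,
          PowerSeries.coeff_derivative, PowerSeries.coeff_succ_X_mul, map_zero]
        simp only [h0, h1, zero_add] at this ⊢
        push_cast at this ⊢
        linear_combination this
      · have := hrec (n + 1)
        simp only [map_add, map_sub, PowerSeries.coeff_C_mul, hc,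
          PowerSeries.coeff_derivative, PowerSeries.coeff_succ_X_mul, map_zero]
        push_cast at this ⊢
        linear_combination this
    rw [hD]
    linear_combination 2 * key
  · have : PowerSeries.constantCoeff P = 1 := by
      rw [← PowerSeries.coeff_zero_eq_constantCoeff_apply, hc, h0]
    simp [this]

/-- The bivariate generating function of the squares of the binomial coefficients. -/
theorem chooseSq_genFun {A : Type*} [CommRing A] [Algebra ℚ A] [IsAddTorsionFree A] (y : A) :
    (PowerSeries.mk fun n => Polynomial.aeval y (chooseSqPoly n)) ^ 2
      * (1 - 2 * (PowerSeries.C (1 + y) * PowerSeries.X)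
        + PowerSeries.C ((1 - y) ^ 2) * PowerSeries.X ^ 2) = 1 := by
  apply PowerSeries.sq_mul_quadratic_eq_one
  · simp [chooseSqPoly]
  · simp [chooseSqPoly, Finset.sum_range_succ]
  · intro n
    simpa [map_ofNat (Polynomial.aeval y)] using
      congrArg (Polynomial.aeval y) (chooseSqPoly_rec n)

/-! ### Setting the two variables equal -/

namespace PowerSeries
open Finset.HasAntidiagonal (antidiagonal mem_antidiagonal)

/-- The value of a power series in two variables on the diagonal. -/
noncomputable def diagEval {R : Type*} [CommRing R] (P : PowerSeries (PowerSeries R)) :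
    PowerSeries R :=
  PowerSeries.mk fun n => ∑ p ∈ antidiagonal n,
    PowerSeries.coeff p.2 (PowerSeries.coeff p.1 P)

variable {R : Type*} [CommRing R]

theorem diagEval_add (P Q : PowerSeries (PowerSeries R)) :
    diagEval (P + Q) = diagEval P + diagEval Q := by
  ext n
  simp [diagEval, Finset.sum_add_distrib]

theorem diagEval_sub (P Q : PowerSeries (PowerSeries R)) :
    diagEval (P - Q) = diagEval P - diagEval Q := by
  ext n
  simp [diagEval, Finset.sum_sub_distrib]

theorem diagEval_mul (P Q : PowerSeries (PowerSeries R)) :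
    diagEval (P * Q) = diagEval P * diagEval Q := by
  ext n
  simp only [diagEval, coeff_mk, coeff_mul, map_sum, Finset.sum_mul_sum]
  simp only [Finset.sum_sigma']
  -- Both maps transpose the 2 × 2 array of exponents (factor against variable), so the map is its
  -- own inverse.
  refine Finset.sum_nbij'
    (fun x => ⟨(x.2.1.1 + x.2.2.1, x.2.1.2 + x.2.2.2), (x.2.1.1, x.2.2.1), (x.2.1.2, x.2.2.2)⟩)
    (fun x => ⟨(x.2.1.1 + x.2.2.1, x.2.1.2 + x.2.2.2), (x.2.1.1, x.2.2.1), (x.2.1.2, x.2.2.2)⟩)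
    ?_ ?_ ?_ ?_ ?_
  · rintro ⟨⟨a, b⟩, ⟨c, d⟩, ⟨e, f⟩⟩ h
    simp only [Finset.mem_sigma, mem_antidiagonal] at h ⊢
    simp only [and_true] at h ⊢
    omega
  · rintro ⟨⟨a, b⟩, ⟨c, d⟩, ⟨e, f⟩⟩ h
    simp only [Finset.mem_sigma, mem_antidiagonal] at h ⊢
    simp only [and_true] at h ⊢
    omega
  · rintro ⟨⟨a, b⟩, ⟨c, d⟩, ⟨e, f⟩⟩ h
    simp only [Finset.mem_sigma, mem_antidiagonal] at h ⊢
    obtain ⟨-, rfl, rfl⟩ := h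
    rfl
  · rintro ⟨⟨a, b⟩, ⟨c, d⟩, ⟨e, f⟩⟩ h
    simp only [Finset.mem_sigma, mem_antidiagonal] at h ⊢
    obtain ⟨-, rfl, rfl⟩ := h
    rfl
  · rintro ⟨⟨a, b⟩, ⟨c, d⟩, ⟨e, f⟩⟩ h
    rfl

theorem diagEval_C (a : PowerSeries R) : diagEval (C a) = a := by
  ext n
  simp only [diagEval, coeff_mk]
  rw [Finset.sum_eq_single (0, n)]
  · simp
  · rintro ⟨i, j⟩ hij hne
    rw [mem_antidiagonal] at hij
    have : i ≠ 0 := by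
      rintro rfl
      simp_all
    simp [coeff_C, this]
  · simp

theorem diagEval_X : diagEval (X : PowerSeries (PowerSeries R)) = X := by
  ext n
  simp only [diagEval, coeff_mk]
  rcases n with _ | n
  · simp
  · rw [Finset.sum_eq_single (1, n)]
    · simp [coeff_one, coeff_X]
    · rintro ⟨i, j⟩ hij hne
      rw [mem_antidiagonal] at hij
      have : i ≠ 1 := by
        rintro rfl
        apply hne
        simp only [Prod.mk.injEq, true_and]
        simp only at hij
        omega
      simp [coeff_X, this]
    · simp [add_comm]

end PowerSeries

/-! ### Fibres of the Carolina solitaire map -/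

/-- The lists of length `n` whose sublist of nonzero entries is `e`, when `e` has no zero. -/
def zeroInsertions : ℕ → List ℕ → Finset (List ℕ)
  | 0, [] => {[]}
  | 0, _ :: _ => ∅
  | n + 1, [] => (zeroInsertions n []).image (List.cons 0)
  | n + 1, a :: e =>
    (zeroInsertions n (a :: e)).image (List.cons 0) ∪ (zeroInsertions n e).image (List.cons a)

theorem mem_zeroInsertions (n : ℕ) (e l : List ℕ) (he : ∀ a ∈ e, a ≠ 0) :
    l ∈ zeroInsertions n e ↔ l.length = n ∧ l.filter (fun a => a ≠ 0) = e := by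
  induction n generalizing e l with
  | zero =>
    rcases e with _ | ⟨a, e⟩
    · simp +contextual [zeroInsertions, List.length_eq_zero_iff]
    · simp +contextual [zeroInsertions, List.length_eq_zero_iff]
  | succ n ih =>
    rcases l with _ | ⟨b, l⟩
    · rcases e with _ | ⟨a, e⟩ <;> simp [zeroInsertions]
    · rcases e with _ | ⟨a, e⟩
      · by_cases hb : b = 0
        · subst hb
          simp [zeroInsertions, ih, and_assoc]
        · simp [zeroInsertions, hb, Ne.symm hb]
      · have ha : a ≠ 0 := he a List.mem_cons_self
        have he' : ∀ c ∈ e, c ≠ 0 := fun c hc => he c (List.mem_cons_of_mem _ hc)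
        have h1 := ih (a :: e) l he
        have h2 := ih e l he'
        by_cases hb : b = 0
        · subst hb
          simp only [zeroInsertions, Finset.mem_union, Finset.mem_image, List.cons.injEq]
          simp [h1, ha]
        · simp only [zeroInsertions, Finset.mem_union, Finset.mem_image, List.cons.injEq]
          simp [h2, hb, Ne.symm hb]
          tauto

theorem card_zeroInsertions (n : ℕ) (e : List ℕ) (he : ∀ a ∈ e, a ≠ 0) :
    (zeroInsertions n e).card = n.choose e.length := by
  induction n generalizing e with
  | zero => rcases e with _ | ⟨a, e⟩ <;> simp [zeroInsertions]
  | succ n ih =>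
    rcases e with _ | ⟨a, e⟩
    · rw [zeroInsertions, Finset.card_image_of_injective _ List.cons_injective, ih [] he]
      simp
    · have ha : a ≠ 0 := he a List.mem_cons_self
      rw [zeroInsertions, Finset.card_union_of_disjoint,
        Finset.card_image_of_injective _ List.cons_injective,
        Finset.card_image_of_injective _ List.cons_injective, ih _ he,
        ih _ (fun c hc => he c (List.mem_cons_of_mem _ hc)), List.length_cons,
        Nat.choose_succ_succ', add_comm]
      -- The two kinds of list start with `0` and with `a ≠ 0`, so Pascal's rule counts them without
      -- overlap.
      rw [Finset.disjoint_left]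
      intro l h1 h2
      obtain ⟨_, -, rfl⟩ := Finset.mem_image.mp h1
      obtain ⟨_, -, h⟩ := Finset.mem_image.mp h2
      exact ha (List.cons.inj h).1

/-- The composition of `n` with first block `i + 1` followed by the blocks of `c`. -/
def Composition.consSucc {n i : ℕ} (h : i < n) (c : Composition (n - 1 - i)) : Composition n where
  blocks := (i + 1) :: c.blocks
  blocks_pos := by
    intro a ha
    rcases List.mem_cons.mp ha with rfl | ha
    · omega
    · exact c.blocks_pos ha
  blocks_sum := by
    rw [List.sum_cons, c.blocks_sum]
    omega

/-- Splits off the first block. Summing a function of the block list keeps the dependent type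
`Composition (n - 1 - i)` out of the summand. -/
theorem Composition.sum_eq_sum_cons {M : Type*} [AddCommMonoid M] {n : ℕ} (hn : 1 ≤ n)
    (f : List ℕ → M) :
    ∑ c : Composition n, f c.blocks =
      ∑ i ∈ Finset.range n, ∑ c : Composition (n - 1 - i), f ((i + 1) :: c.blocks) := by
  rw [Finset.sum_range fun i => ∑ c : Composition (n - 1 - i), f ((i + 1) :: c.blocks),
    ← Fintype.sum_sigma']
  symm
  refine Fintype.sum_bijective
    (fun x : (Σ i : Fin n, Composition (n - 1 - i)) => Composition.consSucc x.1.2 x.2)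
    ⟨?_, ?_⟩ _ _ (fun x => rfl)
  · rintro ⟨⟨i, hi⟩, c⟩ ⟨⟨j, hj⟩, d⟩ h
    have h' := congrArg Composition.blocks h
    simp only [Composition.consSucc, List.cons.injEq, add_left_inj] at h'
    obtain ⟨rfl, h'⟩ := h'
    congr 1
    exact Composition.ext h'
  · intro c
    rcases hc : c.blocks with _ | ⟨a, l⟩
    · rw [c.blocks_eq_nil] at hc
      omega
    · have ha : 0 < a := c.blocks_pos (hc ▸ List.mem_cons_self)
      have hs := c.blocks_sum
      rw [hc, List.sum_cons] at hs
      refine ⟨⟨⟨a - 1, by omega⟩, ⟨l, ?_, ?_⟩⟩, ?_⟩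
      · intro i hi
        exact c.blocks_pos (hc ▸ List.mem_cons_of_mem _ hi)
      · simp only
        omega
      · apply Composition.ext
        simp only [Composition.consSucc, hc, List.cons.injEq, and_true]
        omega

theorem ncard_carolina_fiber {n : ℕ} (d : Composition n) (l : ℕ) (e : List ℕ)
    (hd : d.blocks = l :: e) :
    ((carolina : Composition n → Composition n) ⁻¹' {d}).ncard = l.choose e.length := by
  have he : ∀ a ∈ e, a ≠ 0 := fun a ha =>
    (d.blocks_pos (hd ▸ List.mem_cons_of_mem _ ha)).ne'
  have hl : l ≠ 0 := (d.blocks_pos (hd ▸ List.mem_cons_self)).ne'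
  have hs := d.blocks_sum
  rw [hd, List.sum_cons] at hs
  rw [← card_zeroInsertions l e he, ← Set.ncard_coe_finset]
  refine Set.ncard_congr (fun c _ => c.blocks.map (fun a => a - 1)) ?_ ?_ ?_
  · intro c hc
    have hc' : carolinaList c.blocks = l :: e := hd ▸ congrArg Composition.blocks hc
    rw [Finset.mem_coe, mem_zeroInsertions _ _ _ he]
    -- If `c` were empty, the leading entry `ℓ = 0` would itself be deleted, leaving no block `l`.
    by_cases h0 : c.blocks.length = 0
    · rw [List.length_eq_zero_iff] at h0
      simp [carolinaList, h0] at hc'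
    · rw [carolinaList, List.filter_cons_of_pos (by simpa using h0)] at hc'
      exact ⟨by simpa using (List.cons.inj hc').1, (List.cons.inj hc').2⟩
  · intro c c' _ _ h
    apply Composition.ext
    have key : ∀ l : List ℕ, (∀ a ∈ l, 0 < a) →
        (l.map (fun a => a - 1)).map (fun a => a + 1) = l := fun l hl => by
      rw [List.map_map]
      conv_rhs => rw [← List.map_id l]
      exact List.map_congr_left fun a ha => Nat.succ_pred_eq_of_pos (hl a ha)
    rw [← key c.blocks fun a ha => c.blocks_pos ha, ← key c'.blocks fun a ha => c'.blocks_pos ha]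
    exact congrArg _ h
  · intro m hm
    rw [Finset.mem_coe, mem_zeroInsertions _ _ _ he] at hm
    obtain ⟨hm1, hm2⟩ := hm
    have hmap : (m.map (fun a => a + 1)).map (fun a => a - 1) = m := by
      rw [List.map_map]
      conv_rhs => rw [← List.map_id m]
      exact List.map_congr_left fun _ _ => rfl
    have hpos : ∀ a ∈ m.map (fun a => a + 1), 0 < a := by simp
    refine ⟨⟨m.map (fun a => a + 1), fun {a} ha => hpos a ha, ?_⟩, ?_, hmap⟩
    · rw [← length_add_sum_map_pred _ hpos, hmap, List.length_map, hm1,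
        ← sum_filter_ne_zero_list m, hm2, hs]
    · rw [Set.mem_preimage, Set.mem_singleton_iff]
      apply Composition.ext
      rw [hd]
      change carolinaList (m.map (fun a => a + 1)) = l :: e
      rw [carolinaList, hmap, List.length_map, hm1, List.filter_cons_of_pos (by simpa using hl),
        hm2]

/-- Both sides count pairs of points with the same image. -/
theorem sum_ncard_fiber {α β : Type*} [Fintype α] [Fintype β] (f : α → β) :
    ∑ x, (f ⁻¹' {f x}).ncard = ∑ y, (f ⁻¹' {y}).ncard ^ 2 := by
  classical
  rw [← Finset.sum_fiberwise (s := Finset.univ) (g := f)]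
  refine Finset.sum_congr rfl fun y _ => ?_
  rw [Finset.sum_congr rfl (g := fun _ => (f ⁻¹' {y}).ncard) (by
    intro x hx
    rw [(Finset.mem_filter.mp hx).2]), Finset.sum_const, smul_eq_mul, sq]
  congr 1
  rw [← Set.ncard_coe_finset]
  congr 1
  ext x
  simp

/-- The number of pairs of compositions of `n` with the same image under `carolina`. -/
def carolinaPairs (n : ℕ) : ℕ :=
  ∑ p ∈ Finset.HasAntidiagonal.antidiagonal n,
    ∑ e : Composition p.2, p.1.choose e.length ^ 2

theorem degNoninj_carolina {n : ℕ} (hn : 1 ≤ n) :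
    degNoninj (carolina : Composition n → Composition n) = (carolinaPairs n : ℝ) / 2 ^ (n - 1) := by
  have key : ∑ c : Composition n, ((carolina : Composition n → Composition n) ⁻¹' {carolina c}).ncard
      = carolinaPairs n := by
    have h1 : ∀ d : Composition n, ((carolina : Composition n → Composition n) ⁻¹' {d}).ncard ^ 2 =
        (fun l : List ℕ => (l.headI.choose l.tail.length) ^ 2) d.blocks := fun d => by
      rcases hd : d.blocks with _ | ⟨l, e⟩
      · rw [d.blocks_eq_nil] at hd
        omega
      · rw [ncard_carolina_fiber d l e hd]
        rfl
    rw [sum_ncard_fiber, Finset.sum_congr rfl fun d _ => h1 d, Composition.sum_eq_sum_cons hn fun l => (l.headI.choose l.tail.length) ^ 2,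
      carolinaPairs, Finset.Nat.sum_antidiagonal_eq_sum_range_succ_mk, Finset.sum_range_succ']
    -- `carolinaPairs` allows first entry `0`, which is no block. For `n ≥ 1` this term vanishes;
    -- for `n = 0` it gives the value `1`.
    have h0 : ∑ e : Composition (n - 0), Nat.choose 0 e.length ^ 2 = 0 := by
      refine Finset.sum_eq_zero fun e _ => ?_
      have : 0 < e.length := e.length_pos_iff.mpr (by omega)
      rw [Nat.choose_eq_zero_of_lt this]
      rfl
    rw [h0, add_zero]
    refine Finset.sum_congr rfl fun i _ => ?_
    rw [Nat.sub_sub, add_comm 1 i]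
    rfl
  rw [degNoninj, ← key, composition_card]
  push_cast
  rw [one_div, div_eq_inv_mul]

/-! ### The generating function -/

open PowerSeries in
theorem mk_card_compositions (k : ℕ) :
    (PowerSeries.mk fun n => ((Finset.univ.filter fun c : Composition n => c.length = k).card : ℚ))
      = (X * PowerSeries.mk 1) ^ k := by
  have hcard : ∀ k n, (Finset.univ.filter fun c : Composition n => c.length = k).card =
      ∑ c : Composition n, (fun l : List ℕ => if l.length = k then 1 else 0) c.blocks := by
    intro k n
    rw [Finset.card_filter]
  induction k with
  | zero =>
    ext n
    rw [coeff_mk, pow_zero, coeff_one]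
    rcases n with _ | n
    · simp [composition_card]
    · simp
  | succ k ih =>
    rw [pow_succ', ← ih, mul_assoc]
    ext n
    rcases n with _ | n
    · simp
      intro c
      have : c.length = 0 := c.length_eq_zero.mpr rfl
      omega
    · rw [coeff_succ_X_mul, coeff_mul, coeff_mk, hcard,
        Composition.sum_eq_sum_cons (by omega) fun l => if l.length = k + 1 then 1 else 0,
        Finset.Nat.sum_antidiagonal_eq_sum_range_succ_mk]
      push_cast
      refine Finset.sum_congr rfl fun i _ => ?_
      simp only [coeff_mk, hcard, Pi.one_apply, one_mul]
      push_cast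
      simp

open PowerSeries in
theorem mk_sum_choose_sq (l : ℕ) :
    (PowerSeries.mk fun n => ((∑ e : Composition n, l.choose e.length ^ 2 : ℕ) : ℚ)) =
      Polynomial.aeval (X * PowerSeries.mk 1 : PowerSeries ℚ) (chooseSqPoly l) := by
  rw [chooseSqPoly, map_sum]
  simp only [map_mul, Polynomial.aeval_C, map_pow, Polynomial.aeval_X, ← mk_card_compositions]
  ext n
  rw [coeff_mk, map_sum]
  have : ∀ e : Composition n, l.choose e.length ^ 2 =
      ∑ k ∈ Finset.range (l + 1), if e.length = k then l.choose k ^ 2 else 0 := fun e => by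
    rw [Finset.sum_ite_eq]
    split_ifs with h
    · rfl
    · rw [Nat.choose_eq_zero_of_lt (by simpa using h)]
      rfl
  rw [Finset.sum_congr rfl fun e _ => this e, Finset.sum_comm]
  push_cast
  refine Finset.sum_congr rfl fun k _ => ?_
  have hC : (l.choose k : PowerSeries ℚ) ^ 2 = C ((l.choose k : ℚ) ^ 2) := by simp
  rw [hC, PowerSeries.coeff_C_mul, coeff_mk,
    Finset.card_filter]
  push_cast
  rw [Finset.mul_sum]
  simp

open PowerSeries in
theorem carolinaPairs_genFun :
    (PowerSeries.mk fun n => (carolinaPairs n : ℚ)) ^ 2 *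
      (1 - 4 * X + 4 * X ^ 2 - 4 * X ^ 3 + 4 * X ^ 4) = (1 - X) ^ 2 := by
  set y : PowerSeries ℚ := X * PowerSeries.mk 1
  have hy : y * (1 - X) = X := by
    rw [mul_assoc, PowerSeries.mk_one_mul_one_sub_eq_one, mul_one]
  -- The outer variable marks the first block and the inner one the sum of the others; the diagonal
  -- forgets the difference.
  have hF : (PowerSeries.mk fun n => (carolinaPairs n : ℚ)) =
      diagEval (PowerSeries.mk fun l => Polynomial.aeval y (chooseSqPoly l)) := by
    ext n
    rw [coeff_mk, diagEval, coeff_mk, carolinaPairs]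
    push_cast
    refine Finset.sum_congr rfl fun p _ => ?_
    rw [coeff_mk, ← mk_sum_choose_sq, coeff_mk]
    push_cast
    rfl
  have : IsAddTorsionFree (PowerSeries ℚ) := .of_module_rat _
  have h := congrArg diagEval (chooseSq_genFun y)
  rw [sq, sq X, two_mul] at h
  simp only [diagEval_mul, diagEval_add, diagEval_sub, diagEval_C, diagEval_X] at h
  have h1 : diagEval (1 : PowerSeries (PowerSeries ℚ)) = 1 := by
    rw [← map_one (C (R := PowerSeries ℚ)), diagEval_C]
  rw [h1, ← hF] at h
  set F := PowerSeries.mk fun n => (carolinaPairs n : ℚ)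
  linear_combination (1 - X) ^ 2 * h
    + F ^ 2 * (2 * (1 - X) * X + X ^ 2 * (2 - 3 * X - y * (1 - X))) * hy

/-! ### Asymptotics -/

/-- The coefficients of `(1 - x) ^ (-1/2)`. -/
noncomputable def invSqrtCoeff (n : ℕ) : ℝ := (n.centralBinom : ℝ) / 4 ^ n

theorem invSqrtCoeff_zero : invSqrtCoeff 0 = 1 := by simp [invSqrtCoeff]

theorem invSqrtCoeff_pos (n : ℕ) : 0 < invSqrtCoeff n :=
  div_pos (by exact_mod_cast n.centralBinom_pos) (by positivity)

theorem invSqrtCoeff_succ (n : ℕ) :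
    2 * (n + 1) * invSqrtCoeff (n + 1) = (2 * n + 1) * invSqrtCoeff n := by
  have h : ((n : ℝ) + 1) * (n + 1).centralBinom = 2 * (2 * n + 1) * n.centralBinom := by
    exact_mod_cast Nat.succ_mul_centralBinom_succ n
  rw [invSqrtCoeff, invSqrtCoeff, pow_succ]
  field_simp
  linear_combination 2 * h

/-- As `invSqrtCoeff n` is the product of the `(2k - 1) / (2k)`, its square times Wallis' product
telescopes to `1 / (2n + 1)`. -/
theorem invSqrtCoeff_sq_mul_wallis (n : ℕ) :
    invSqrtCoeff n ^ 2 * ((2 * n + 1) * Real.Wallis.W n) = 1 := by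
  induction n with
  | zero => simp [invSqrtCoeff_zero, Real.Wallis.W]
  | succ n ih =>
    have h := invSqrtCoeff_succ n
    have h' : invSqrtCoeff (n + 1) = (2 * n + 1) * invSqrtCoeff n / (2 * (n + 1)) := by
      rw [eq_div_iff (by positivity)]
      linear_combination h
    rw [h', Real.Wallis.W_succ]
    push_cast
    refine Eq.trans ?_ ih
    field_simp
    ring

open Filter Topology

theorem tendsto_invSqrtCoeff_mul_sqrt :
    Tendsto (fun n : ℕ => invSqrtCoeff n * √(Real.pi * n)) atTop (𝓝 1) := by
  have h1 : Tendsto (fun n : ℕ => (n : ℝ) / (2 * n + 1) * (Real.pi / Real.Wallis.W n)) atTop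
      (𝓝 1) := by
    have h := Stirling.tendsto_self_div_two_mul_self_add_one.mul
      (Tendsto.div (tendsto_const_nhds (x := Real.pi)) Real.Wallis.tendsto_W_nhds_pi_div_two
        (by positivity))
    have he : (1 / 2 : ℝ) * (Real.pi / (Real.pi / 2)) = 1 := by
      field_simp
    rw [he] at h
    exact h
  have h2 := (Real.continuous_sqrt.tendsto 1).comp h1
  rw [Real.sqrt_one] at h2
  refine h2.congr fun n => ?_
  have hW := Real.Wallis.W_pos n
  rw [Function.comp_apply, ← Real.sqrt_sq (invSqrtCoeff_pos n).le, ← Real.sqrt_mul (sq_nonneg _)]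
  congr 1
  have h := invSqrtCoeff_sq_mul_wallis n
  have h' : invSqrtCoeff n ^ 2 = 1 / ((2 * n + 1) * Real.Wallis.W n) := by
    rw [eq_div_iff (by positivity), h]
  rw [h']
  field_simp

/-- Holds because `(m + 1) * invSqrtCoeff m` is nondecreasing in `m`; it supplies the dominating
sequence for the coefficient transfer. -/
theorem invSqrtCoeff_le (m k : ℕ) : invSqrtCoeff m ≤ (k + 1) * invSqrtCoeff (m + k) := by
  have h : (m + 1) * invSqrtCoeff m ≤ (m + k + 1) * invSqrtCoeff (m + k) := by
    induction k with
    | zero => simp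
    | succ k ih =>
      refine ih.trans ?_
      have h1 := invSqrtCoeff_succ (m + k)
      have h2 := invSqrtCoeff_pos (m + k + 1)
      have h3 := invSqrtCoeff_pos (m + k)
      push_cast at h1 ⊢
      simp only [← add_assoc]
      have hm : (0 : ℝ) ≤ m + k := by positivity
      generalize (m : ℝ) + k = x at *
      have h4 : invSqrtCoeff (m + k + 1) =
          (2 * x + 1) * invSqrtCoeff (m + k) / (2 * (x + 1)) := by
        rw [eq_div_iff (by positivity)]
        linear_combination h1
      rw [h4, ← mul_div_assoc, le_div_iff₀ (by positivity)]
      nlinarith [mul_nonneg hm h3.le]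
  have hp := invSqrtCoeff_pos (m + k)
  have hm : (0 : ℝ) ≤ m := by positivity
  have hk : (0 : ℝ) ≤ k := by positivity
  have : (m + 1) * invSqrtCoeff m ≤ (m + 1) * ((k + 1) * invSqrtCoeff (m + k)) := by
    refine h.trans ?_
    rw [← mul_assoc]
    refine mul_le_mul_of_nonneg_right ?_ hp.le
    nlinarith [mul_nonneg hm hk]
  exact le_of_mul_le_mul_left this (by positivity)

theorem tendsto_invSqrtCoeff_ratio (k : ℕ) :
    Tendsto (fun n => invSqrtCoeff (n - k) / invSqrtCoeff n) atTop (𝓝 1) := by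
  rw [← tendsto_add_atTop_iff_nat k]
  simp only [Nat.add_sub_cancel]
  induction k with
  | zero => simp [div_self (invSqrtCoeff_pos _).ne']
  | succ k ih =>
    have h1 : Tendsto (fun n : ℕ => invSqrtCoeff n / invSqrtCoeff (n + 1)) atTop (𝓝 1) := by
      have h : Tendsto (fun n : ℕ => 1 + 1 / 2 * (1 / ((n : ℝ) + 1 / 2))) atTop
          (𝓝 (1 + 1 / 2 * 0)) := by
        refine tendsto_const_nhds.add (tendsto_const_nhds.mul ?_)
        refine tendsto_const_nhds.div_atTop ?_
        exact tendsto_atTop_add_const_right _ _ tendsto_natCast_atTop_atTop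
      rw [mul_zero, add_zero] at h
      refine h.congr fun n => ?_
      rw [eq_div_iff (invSqrtCoeff_pos _).ne']
      have h2 := invSqrtCoeff_succ n
      have hn : (n : ℝ) + 1 / 2 ≠ 0 := by positivity
      field_simp
      linear_combination h2
    have h2 := ih.mul (h1.comp (tendsto_add_atTop_nat k))
    rw [mul_one] at h2
    refine h2.congr fun n => ?_
    simp only [Function.comp_apply]
    rw [div_mul_div_cancel₀ (invSqrtCoeff_pos _).ne', add_assoc]

/-- Coefficient transfer at a singularity of type `(1 - x) ^ (-1/2)`. -/
theorem tendsto_conv_invSqrtCoeff {g : ℕ → ℝ} {M q : ℝ} (hq0 : 0 ≤ q) (hq1 : q < 1)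
    (hg : ∀ k, |g k| ≤ M * q ^ k) :
    Tendsto (fun n => (∑ p ∈ Finset.HasAntidiagonal.antidiagonal n, g p.1 * invSqrtCoeff p.2)
      / invSqrtCoeff n) atTop (𝓝 (∑' k, g k)) := by
  have hM : 0 ≤ M := by
    have := (abs_nonneg _).trans (hg 0)
    simpa using this
  let f : ℕ → ℕ → ℝ := fun n k =>
    if k ≤ n then g k * (invSqrtCoeff (n - k) / invSqrtCoeff n) else 0
  have hf : ∀ n, (∑ p ∈ Finset.HasAntidiagonal.antidiagonal n, g p.1 * invSqrtCoeff p.2)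
      / invSqrtCoeff n = ∑' k, f n k := fun n => by
    rw [Finset.Nat.sum_antidiagonal_eq_sum_range_succ_mk, Finset.sum_div,
      tsum_eq_sum (s := Finset.range (n + 1))]
    · refine Finset.sum_congr rfl fun k hk => ?_
      have : k ≤ n := Nat.lt_succ_iff.mp (Finset.mem_range.mp hk)
      simp only [f, if_pos this, mul_div_assoc]
    · intro k hk
      have : ¬ k ≤ n := fun h => hk (Finset.mem_range.mpr (Nat.lt_succ_of_le h))
      simp only [f, if_neg this]
  simp_rw [hf]
  -- For fixed `k` the ratio of coefficients tends to `1`; it is at most `k + 1`, so `M (k + 1) q ^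
  -- k` dominates.
  refine tendsto_tsum_of_dominated_convergence
    (bound := fun k => M * (((k : ℝ) ^ 1 * q ^ k) + q ^ k)) ?_ ?_ ?_
  · refine Summable.mul_left _ (Summable.add ?_ (summable_geometric_of_lt_one hq0 hq1))
    refine summable_pow_mul_geometric_of_norm_lt_one 1 ?_
    rwa [Real.norm_of_nonneg hq0]
  · intro k
    have h := (tendsto_invSqrtCoeff_ratio k).const_mul (g k)
    rw [mul_one] at h
    refine h.congr' ?_
    filter_upwards [eventually_ge_atTop k] with n hn
    simp only [f, if_pos hn]
  · refine Eventually.of_forall fun n k => ?_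
    have h0 : 0 ≤ M * (((k : ℝ) ^ 1 * q ^ k) + q ^ k) := by positivity
    by_cases hk : k ≤ n
    · simp only [f, if_pos hk, Real.norm_eq_abs, abs_mul]
      have h1 : |invSqrtCoeff (n - k) / invSqrtCoeff n| ≤ k + 1 := by
        rw [abs_of_pos (div_pos (invSqrtCoeff_pos _) (invSqrtCoeff_pos _)),
          div_le_iff₀ (invSqrtCoeff_pos _)]
        have := invSqrtCoeff_le (n - k) k
        rwa [Nat.sub_add_cancel hk] at this
      calc |g k| * |invSqrtCoeff (n - k) / invSqrtCoeff n| ≤ M * q ^ k * (k + 1) :=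
            mul_le_mul (hg k) h1 (abs_nonneg _) (by positivity)
        _ = _ := by ring
    · simpa only [f, if_neg hk, norm_zero] using h0

theorem mk_invSqrtCoeff_sq (t : ℝ) :
    (PowerSeries.mk fun n => invSqrtCoeff n * t ^ n) ^ 2
      * (1 - PowerSeries.C t * PowerSeries.X) = 1 := by
  set B : PowerSeries ℝ := PowerSeries.mk fun n => invSqrtCoeff n * t ^ n with hB
  have hc : ∀ n, PowerSeries.coeff n B = invSqrtCoeff n * t ^ n := fun n => by
    rw [hB, PowerSeries.coeff_mk]
  apply PowerSeries.sq_mul_eq_one_of_derivative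
  · have hD : PowerSeries.derivative ℝ (1 - PowerSeries.C t * PowerSeries.X) =
        - PowerSeries.C t := by
      simp [Derivation.map_one_eq_zero]
    have key : (PowerSeries.derivative ℝ B + PowerSeries.derivative ℝ B)
        - PowerSeries.C t * (PowerSeries.X * PowerSeries.derivative ℝ B
          + PowerSeries.X * PowerSeries.derivative ℝ B) - PowerSeries.C t * B = 0 := by
      ext n
      have h := invSqrtCoeff_succ n
      rcases n with _ | n
      · simp only [map_add, map_sub, PowerSeries.coeff_C_mul, PowerSeries.coeff_zero_X_mul, hc,
          PowerSeries.coeff_derivative, map_zero]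
        push_cast at h ⊢
        linear_combination t * h
      · simp only [map_add, map_sub, PowerSeries.coeff_C_mul, PowerSeries.coeff_succ_X_mul, hc,
          PowerSeries.coeff_derivative, map_zero]
        push_cast at h ⊢
        linear_combination t ^ (n + 2) * h
    rw [hD]
    linear_combination key
  · have : PowerSeries.constantCoeff B = 1 := by
      rw [← PowerSeries.coeff_zero_eq_constantCoeff_apply, hc, invSqrtCoeff_zero]
      simp
    simp [this]

/-! ### Evaluation at a point and coefficient bounds -/

namespace PowerSeries

theorem summable_tsum_coeff_mul {P Q : PowerSeries ℝ} {x : ℝ}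
    (hP : Summable fun n => ‖coeff n P * x ^ n‖) (hQ : Summable fun n => ‖coeff n Q * x ^ n‖) :
    (Summable fun n => ‖coeff n (P * Q) * x ^ n‖) ∧
    ∑' n, coeff n (P * Q) * x ^ n = (∑' n, coeff n P * x ^ n) * ∑' n, coeff n Q * x ^ n := by
  have h : ∀ n, coeff n (P * Q) * x ^ n =
      ∑ p ∈ Finset.HasAntidiagonal.antidiagonal n,
        (coeff p.1 P * x ^ p.1) * (coeff p.2 Q * x ^ p.2) := fun n => by
    rw [coeff_mul, Finset.sum_mul]
    refine Finset.sum_congr rfl fun p hp => ?_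
    rw [← Finset.HasAntidiagonal.mem_antidiagonal.mp hp, pow_add]
    ring
  simp_rw [h]
  obtain ⟨f, hf⟩ : ∃ f : ℕ → ℝ, ∀ n, coeff n P * x ^ n = f n := ⟨_, fun _ => rfl⟩
  obtain ⟨g, hg⟩ : ∃ g : ℕ → ℝ, ∀ n, coeff n Q * x ^ n = g n := ⟨_, fun _ => rfl⟩
  simp only [hf, hg] at hP hQ ⊢
  exact ⟨summable_norm_sum_mul_antidiagonal_of_summable_norm hP hQ,
    (tsum_mul_tsum_eq_tsum_sum_antidiagonal_of_summable_norm hP hQ).symm⟩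

theorem summable_tsum_coeff_polynomial (p : Polynomial ℝ) (x : ℝ) :
    (Summable fun n => ‖coeff n (p : PowerSeries ℝ) * x ^ n‖) ∧
    ∑' n, coeff n (p : PowerSeries ℝ) * x ^ n = p.eval x := by
  have h0 : ∀ n ∉ Finset.range (p.natDegree + 1), coeff n (p : PowerSeries ℝ) * x ^ n = 0 := by
    intro n hn
    rw [Polynomial.coeff_coe, Polynomial.coeff_eq_zero_of_natDegree_lt (by simpa using hn),
      zero_mul]
  refine ⟨summable_of_ne_finset_zero (s := Finset.range (p.natDegree + 1)) fun n hn => by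
    rw [h0 n hn, norm_zero], ?_⟩
  rw [tsum_eq_sum h0, Polynomial.eval_eq_sum_range]
  simp [Polynomial.coeff_coe]

/-- A coefficient bound for the inverse square root of the cubic `1 + a X + b X² + c X³`. -/
theorem abs_coeff_le_two_pow {H : PowerSeries ℝ} {a b c : ℝ}
    (hH : H ^ 2 * (1 + C a * X + C b * X ^ 2 + C c * X ^ 3) = 1)
    (habc : |a| / 2 + |b| / 4 + |c| / 8 ≤ 1) (n : ℕ) : |coeff n H| ≤ 2 ^ n := by
  have h0 : |coeff 0 H| = 1 := by
    have h := congrArg constantCoeff hH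
    simp at h
    rcases h with h | h <;> simp [h]
  have hne : H ≠ 0 := by
    rintro rfl
    simp at hH
  have hD : derivative ℝ (1 + C a * X + C b * X ^ 2 + C c * X ^ 3) =
      C a + 2 * (C b * X) + 3 * (C c * X ^ 2) := by
    simp only [map_add, Derivation.leibniz, Derivation.leibniz_pow,
      Derivation.map_one_eq_zero, derivative_C, derivative_X, smul_eq_mul]
    simp
    ring
  -- Differentiating `H² R = 1` and cancelling `H` gives `2 R H' + R' H = 0`. In the resulting
  -- recurrence the weights `2n + 5`, `2n + 4`, `2n + 3` are all at most `2(n + 3)`, so `habc`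
  -- closes the induction.
  have key : 2 * derivative ℝ H * (1 + C a * X + C b * X ^ 2 + C c * X ^ 3)
      + H * (C a + 2 * (C b * X) + 3 * (C c * X ^ 2)) = 0 := by
    have h := congrArg (derivative ℝ) hH
    rw [Derivation.leibniz, hD, Derivation.leibniz_pow, Derivation.map_one_eq_zero] at h
    simp only [smul_eq_mul, nsmul_eq_mul] at h
    push_cast at h
    refine (mul_eq_zero.mp (?_ : H * _ = 0)).resolve_left hne
    linear_combination h
  have e2 : (2 : PowerSeries ℝ) = C 2 := by simp [map_ofNat]
  have e3 : (3 : PowerSeries ℝ) = C 3 := by simp [map_ofNat]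
  have key' : C 2 * derivative ℝ H + C (2 * a) * (X * derivative ℝ H)
      + C (2 * b) * (X * (X * derivative ℝ H)) + C (2 * c) * (X * (X * (X * derivative ℝ H)))
      + C a * H + C (2 * b) * (X * H) + C (3 * c) * (X * (X * H)) = 0 := by
    simp only [map_mul, ← e2, ← e3]
    linear_combination key
  have hcoef := fun n => congrArg (coeff n) key'
  simp only [map_add, coeff_C_mul, map_zero] at hcoef
  have hXD : ∀ n, coeff n (X * derivative ℝ H) = coeff n H * n := fun n => by
    rcases n with _ | n
    · simp
    · rw [coeff_succ_X_mul, coeff_derivative]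
      push_cast
      rfl
  have ha := abs_nonneg a
  have hb := abs_nonneg b
  have hc := abs_nonneg c
  induction n using Nat.strong_induction_on with
  | _ n ih =>
  rcases n with _ | _ | _ | n
  · rw [h0, pow_zero]
  · have h := hcoef 0
    simp only [coeff_zero_X_mul, coeff_derivative, mul_zero, add_zero] at h
    have : coeff (0 + 1) H = -(a / 2) * coeff 0 H := by
      push_cast at h
      linear_combination h / 2
    rw [this, abs_mul, h0, abs_neg, abs_div]
    norm_num
    linarith
  · have h := hcoef (0 + 1)
    have h1 := ih 1 (by omega)
    simp only [coeff_zero_X_mul, coeff_succ_X_mul, coeff_derivative, mul_zero, add_zero] at h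
    have : coeff (0 + 1 + 1) H = -(3 / 4) * a * coeff 1 H + -(1 / 2) * b * coeff 0 H := by
      push_cast at h
      linear_combination h / 4
    rw [this]
    refine (abs_add_le _ _).trans ?_
    simp only [abs_mul, h0, abs_neg]
    norm_num
    have := mul_le_mul_of_nonneg_left h1 ha
    norm_num at this
    linarith
  · have h := hcoef (n + 2)
    have h1 := ih (n + 2) (by omega)
    have h2 := ih (n + 1) (by omega)
    have h3 := ih n (by omega)
    simp only [hXD, coeff_succ_X_mul, coeff_derivative] at h
    push_cast at h
    have hn : (0 : ℝ) ≤ n := by positivity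
    set u := coeff (n + 2) H
    set v := coeff (n + 1) H
    set w := coeff n H
    have h4 : 2 * ((n : ℝ) + 3) * coeff (n + 2 + 1) H =
        -((2 * n + 5) * (a * u) + (2 * n + 4) * (b * v) + (2 * n + 3) * (c * w)) := by
      linear_combination h
    have h5 : 2 * ((n : ℝ) + 3) * |coeff (n + 2 + 1) H| ≤
        (2 * n + 5) * (|a| * |u|) + (2 * n + 4) * (|b| * |v|) + (2 * n + 3) * (|c| * |w|) := by
      rw [← abs_of_nonneg (show (0 : ℝ) ≤ 2 * ((n : ℝ) + 3) by positivity), ← abs_mul, h4,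
        abs_neg]
      refine (abs_add_three _ _ _).trans (le_of_eq ?_)
      simp only [abs_mul]
      rw [abs_of_nonneg (show (0 : ℝ) ≤ 2 * (n : ℝ) + 5 by positivity),
        abs_of_nonneg (show (0 : ℝ) ≤ 2 * (n : ℝ) + 4 by positivity),
        abs_of_nonneg (show (0 : ℝ) ≤ 2 * (n : ℝ) + 3 by positivity)]
    have h6 : (2 * n + 5) * (|a| * |u|) + (2 * n + 4) * (|b| * |v|) + (2 * n + 3) * (|c| * |w|) ≤
        2 * ((n : ℝ) + 3) * (|a| * 2 ^ (n + 2) + |b| * 2 ^ (n + 1) + |c| * 2 ^ n) := by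
      rw [mul_add, mul_add]
      gcongr <;> linarith
    have h7 : |a| * 2 ^ (n + 2) + |b| * 2 ^ (n + 1) + |c| * 2 ^ n ≤ 2 ^ (n + 3) := by
      have := mul_le_mul_of_nonneg_right habc (show (0 : ℝ) ≤ 2 ^ (n + 3) by positivity)
      rw [one_mul] at this
      refine le_trans (le_of_eq ?_) this
      ring
    have h8 : 2 * ((n : ℝ) + 3) * |coeff (n + 2 + 1) H| ≤ 2 * ((n : ℝ) + 3) * 2 ^ (n + 3) :=
      (h5.trans h6).trans (mul_le_mul_of_nonneg_left h7 (by positivity))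
    exact le_of_mul_le_mul_left h8 (by positivity)

end PowerSeries

/-! ### The generating function characterises the counting sequence -/

theorem carolinaPairs_zero : carolinaPairs 0 = 1 := by
  have h : ∀ e : Composition 0, Nat.choose 0 e.length ^ 2 = 1 := fun e => by
    rw [e.length_eq_zero.mpr rfl]
    rfl
  simp [carolinaPairs, h, composition_card]

section
open PowerSeries

theorem HasCarolinaGF.eq_carolinaPairs {η : ℕ → ℤ} (h : HasCarolinaGF η) (n : ℕ) :
    η n = carolinaPairs n := by
  obtain ⟨S, ⟨hS, hS0⟩, hη⟩ := h
  set E : PowerSeries ℚ := PowerSeries.mk fun n => (η n : ℚ) with hE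
  have hF := carolinaPairs_genFun
  set F : PowerSeries ℚ := PowerSeries.mk fun n => (carolinaPairs n : ℚ) with hFdef
  have hS1 : S * S⁻¹ = 1 := PowerSeries.mul_inv_cancel S (by simp [hS0])
  have hS2 : S ≠ 0 := by
    rintro rfl
    simp at hS0
  -- Both `E` and `F` square to `(1 - X)² / S²`; the constant term `2` of `E + F` excludes `E = -F`.
  have h1 : (E - F) * (E + F) * S ^ 2 = 0 := by
    rw [← hS] at hF
    rw [hη]
    linear_combination (1 - X) ^ 2 * (S * S⁻¹ + 1) * hS1 - hF
  have hE0 : constantCoeff E = 1 := by simp [hη, hS0]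
  have hF0 : constantCoeff F = 1 := by
    rw [← coeff_zero_eq_constantCoeff_apply, hFdef, coeff_mk, carolinaPairs_zero, Nat.cast_one]
  have h2 : E + F ≠ 0 := fun h0 => by
    have := congrArg constantCoeff h0
    simp [hE0, hF0] at this
  have h3 : E = F := sub_eq_zero.mp <|
    (mul_eq_zero.mp ((mul_eq_zero.mp h1).resolve_right (pow_ne_zero 2 hS2))).resolve_right h2
  have h4 := congrArg (coeff n) h3
  rw [hE, hFdef, coeff_mk, coeff_mk] at h4
  exact_mod_cast h4

theorem hasCarolinaGF_carolinaPairs : HasCarolinaGF fun n => (carolinaPairs n : ℤ) := by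
  have hF := carolinaPairs_genFun
  have hFdef : (PowerSeries.mk fun n => (carolinaPairs n : ℚ)) =
      PowerSeries.mk fun n => (((carolinaPairs n : ℕ) : ℤ) : ℚ) := by
    simp
  rw [HasCarolinaGF, ← hFdef]
  set F : PowerSeries ℚ := PowerSeries.mk fun n => (carolinaPairs n : ℚ) with hF'
  have hF0 : constantCoeff F = 1 := by
    rw [← coeff_zero_eq_constantCoeff_apply, hF', coeff_mk, carolinaPairs_zero, Nat.cast_one]
  have hF1 : F * F⁻¹ = 1 := PowerSeries.mul_inv_cancel F (by simp [hF0])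
  refine ⟨(1 - X) * F⁻¹, ⟨?_, by simp [hF0]⟩, ?_⟩
  · rw [mul_pow, ← hF]
    linear_combination (1 - 4 * X + 4 * X ^ 2 - 4 * X ^ 3 + 4 * X ^ 4) * (F * F⁻¹ + 1) * hF1
  · rw [PowerSeries.eq_mul_inv_iff_mul_eq (by simp [hF0])]
    linear_combination (1 - X) * hF1

theorem carolinaPairs_genFun_real :
    (PowerSeries.mk fun n => (carolinaPairs n : ℝ)) ^ 2 *
      (1 - 4 * X + 4 * X ^ 2 - 4 * X ^ 3 + 4 * X ^ 4) = (1 - X) ^ 2 := by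
  have h := congrArg (PowerSeries.map (algebraMap ℚ ℝ)) carolinaPairs_genFun
  have hF : PowerSeries.map (algebraMap ℚ ℝ) (PowerSeries.mk fun n => (carolinaPairs n : ℚ)) =
      PowerSeries.mk fun n => (carolinaPairs n : ℝ) := by
    ext n
    simp
  simpa [hF, map_ofNat] using h

end

/-! ### The dominant root and the asymptotics -/

theorem exists_carolina_root : ∃ ρ : ℝ,
    IsLeast {x : ℝ | 0 < x ∧ 1 - 4 * x + 4 * x ^ 2 - 4 * x ^ 3 + 4 * x ^ 4 = 0} ρ ∧
    |ρ - 0.33933| < 0.000005 := by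
  have hcont : ContinuousOn (fun x : ℝ => 1 - 4 * x + 4 * x ^ 2 - 4 * x ^ 3 + 4 * x ^ 4)
      (Set.Icc 0.33933 0.339334) := by fun_prop
  have hmem : (0 : ℝ) ∈ Set.Icc
      ((fun x : ℝ => 1 - 4 * x + 4 * x ^ 2 - 4 * x ^ 3 + 4 * x ^ 4) 0.339334)
      ((fun x : ℝ => 1 - 4 * x + 4 * x ^ 2 - 4 * x ^ 3 + 4 * x ^ 4) 0.33933) := by
    constructor <;> norm_num
  obtain ⟨ρ, ⟨h1, h2⟩, h3⟩ := intermediate_value_Icc' (by norm_num) hcont hmem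
  simp only at h3
  refine ⟨ρ, ⟨⟨by linarith, h3⟩, ?_⟩, ?_⟩
  · rintro x ⟨hx0, hx⟩
    by_contra! hlt
    -- The difference of the quartic at `x` and at `ρ`, factored; the cofactor is positive since `x
    -- + ρ < 2ρ < 1`.
    have h4 : (ρ - x) * (4 - 4 * (x + ρ) + 4 * x * ρ
        + 4 * (1 - (x + ρ)) * (x ^ 2 + ρ ^ 2)) = 0 := by
      linear_combination hx - h3
    have h5 : 0 < 4 * x * ρ := by positivity
    have h6 : 0 ≤ (1 - (x + ρ)) * (x ^ 2 + ρ ^ 2) := mul_nonneg (by linarith) (by positivity)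
    rcases mul_eq_zero.mp h4 with h | h <;> linarith
  · rw [abs_lt]
    constructor <;> linarith

open PowerSeries in
theorem tendsto_carolinaPairs {ρ : ℝ} (hρ1 : 0.339 < ρ) (hρ2 : ρ < 0.34)
    (hρ : 1 - 4 * ρ + 4 * ρ ^ 2 - 4 * ρ ^ 3 + 4 * ρ ^ 4 = 0) :
    Tendsto (fun n => carolinaPairs n * ρ ^ n / invSqrtCoeff n) atTop
      (𝓝 ((1 - ρ) / (2 * √(1 - 3 * ρ + 2 * ρ ^ 2 - ρ ^ 3)))) := by
  have hρ0 : 0 < ρ := by linarith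
  obtain ⟨t, ht⟩ : ∃ t : ℝ, t = ρ⁻¹ := ⟨_, rfl⟩
  have htρ : t * ρ = 1 := by rw [ht, inv_mul_cancel₀ hρ0.ne']
  have ht1 : 2.94 < t := by
    rw [ht, lt_inv_comm₀ (by norm_num) hρ0]
    exact hρ2.trans (by norm_num)
  have ht2 : t < 2.95 := by
    rw [ht, inv_lt_comm₀ hρ0 (by norm_num)]
    refine lt_trans (by norm_num) hρ1
  have htQ : t * (t * (t - 2) ^ 2 - 4) = -4 := by
    have : t ^ 4 * (1 - 4 * ρ + 4 * ρ ^ 2 - 4 * ρ ^ 3 + 4 * ρ ^ 4) = 0 := by rw [hρ, mul_zero]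
    have h2 : t ^ 4 - 4 * t ^ 3 * (t * ρ) + 4 * t ^ 2 * (t * ρ) ^ 2 - 4 * t * (t * ρ) ^ 3
        + 4 * (t * ρ) ^ 4 = 0 := by linear_combination this
    rw [htρ] at h2
    linear_combination h2
  have hF := carolinaPairs_genFun_real
  set F : PowerSeries ℝ := PowerSeries.mk fun n => (carolinaPairs n : ℝ) with hFdef
  have hB := mk_invSqrtCoeff_sq t
  set B : PowerSeries ℝ := PowerSeries.mk fun n => invSqrtCoeff n * t ^ n with hBdef
  -- Coefficients of the cubic quotient of the quartic by `1 - tX`; the remainder vanishes by `htQ`.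
  obtain ⟨a, ha⟩ : ∃ a : ℝ, a = t - 4 := ⟨_, rfl⟩
  obtain ⟨b, hb⟩ : ∃ b : ℝ, b = (t - 2) ^ 2 := ⟨_, rfl⟩
  obtain ⟨c, hc⟩ : ∃ c : ℝ, c = t * (t - 2) ^ 2 - 4 := ⟨_, rfl⟩
  set R : PowerSeries ℝ := 1 + C a * X + C b * X ^ 2 + C c * X ^ 3 with hR
  have h4 : (4 : PowerSeries ℝ) = C 4 := by simp [map_ofNat]
  have hQ : (1 - 4 * X + 4 * X ^ 2 - 4 * X ^ 3 + 4 * X ^ 4 : PowerSeries ℝ) =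
      (1 - C t * X) * R := by
    have e1 : C a - C t = -C 4 := by rw [← map_sub, ← map_neg]; congr 1; linarith
    have e2 : C b - C t * C a = C 4 := by
      rw [← map_mul, ← map_sub]; congr 1; rw [hb, ha]; ring
    have e3 : C c - C t * C b = -C 4 := by
      rw [← map_mul, ← map_sub, ← map_neg]; congr 1; rw [hb, hc]; ring
    have e4 : C t * C c = -C 4 := by
      rw [← map_mul, ← map_neg]; congr 1; rw [hc, htQ]
    rw [hR, h4]
    linear_combination -X * e1 - X ^ 2 * e2 - X ^ 3 * e3 + X ^ 4 * e4
  set G : PowerSeries ℝ := F * B * (1 - C t * X) with hG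
  have hFG : F = G * B := by
    rw [hG]
    linear_combination -F * hB
  have hX1 : (PowerSeries.mk 1 : PowerSeries ℝ) * (1 - X) = 1 := mk_one_mul_one_sub_eq_one ℝ
  have hGR : G ^ 2 * R = (1 - X) ^ 2 := by
    rw [← hF, hQ, hG]
    linear_combination F ^ 2 * (1 - C t * X) * R * hB
  -- Dividing by `1 - X` leaves a pure inverse square root of `R`, to which the `2 ^ n` bound
  -- applies.
  set H : PowerSeries ℝ := G * PowerSeries.mk 1 with hH
  have hGH : G = H - X * H := by
    rw [hH]
    linear_combination -G * hX1
  have hHR : H ^ 2 * R = 1 := by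
    rw [hH]
    linear_combination (PowerSeries.mk 1) ^ 2 * hGR
      + ((PowerSeries.mk 1 : PowerSeries ℝ) * (1 - X) + 1) * hX1
  have habc : |a| / 2 + |b| / 4 + |c| / 8 ≤ 1 := by
    have hb1 : b ≤ 0.9025 := by rw [hb]; nlinarith
    have hb2 : 0.88 ≤ b := by rw [hb]; nlinarith
    have hc1 : c = t * b - 4 := by rw [hc, hb]
    have hc2 : 2.58 ≤ t * b := by nlinarith
    have hc3 : t * b ≤ 2.7 := by nlinarith
    rw [abs_of_neg (show a < 0 by linarith), abs_of_pos (show 0 < b by linarith),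
      abs_of_neg (show c < 0 by linarith)]
    linarith
  have hHb := abs_coeff_le_two_pow hHR habc
  have hGb : ∀ n, |coeff n G * ρ ^ n| ≤ 2 * (2 * ρ) ^ n := fun n => by
    have h1 : |coeff n G| ≤ 2 * 2 ^ n := by
      rw [hGH, map_sub]
      rcases n with _ | n
      · rw [coeff_zero_X_mul, sub_zero]
        refine (hHb 0).trans (by norm_num)
      · rw [coeff_succ_X_mul]
        refine (abs_sub _ _).trans ?_
        have h2 := hHb (n + 1)
        have h3 := hHb n
        rw [pow_succ] at h2 ⊢
        have : (0 : ℝ) ≤ 2 ^ n := by positivity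
        linarith
    rw [abs_mul, abs_of_pos (pow_pos hρ0 n), mul_pow, ← mul_assoc]
    exact mul_le_mul_of_nonneg_right h1 (by positivity)
  have hlim := tendsto_conv_invSqrtCoeff (by positivity) (by linarith) hGb
  have hcoef : ∀ n, ∑ p ∈ Finset.HasAntidiagonal.antidiagonal n,
      coeff p.1 G * ρ ^ p.1 * invSqrtCoeff p.2 = carolinaPairs n * ρ ^ n := fun n => by
    have h1 : coeff n F = carolinaPairs n := by rw [hFdef, coeff_mk]
    rw [← h1, hFG, coeff_mul, Finset.sum_mul]
    refine Finset.sum_congr rfl fun p hp => ?_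
    have h2 : t ^ p.2 * ρ ^ p.2 = 1 := by rw [← mul_pow, htρ, one_pow]
    rw [← Finset.HasAntidiagonal.mem_antidiagonal.mp hp, hBdef, coeff_mk, pow_add]
    linear_combination -(coeff p.1 G * ρ ^ p.1 * invSqrtCoeff p.2) * h2
  simp only [hcoef] at hlim
  set γ : ℝ := ∑' k, coeff k G * ρ ^ k with hγ
  -- Evaluating `G² R = (1 - X)²` at `ρ` only gives `γ²`; the sign comes from `γ` being a limit of
  -- nonnegative ratios.
  have hγ0 : 0 ≤ γ := ge_of_tendsto' hlim fun n =>
    div_nonneg (by positivity) (invSqrtCoeff_pos n).le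
  have hGs : Summable fun n => ‖coeff n G * ρ ^ n‖ :=
    Summable.of_nonneg_of_le (fun _ => norm_nonneg _) hGb
      ((summable_geometric_of_lt_one (by positivity) (by linarith)).mul_left 2)
  have hRs := summable_tsum_coeff_polynomial (1 + Polynomial.C a * Polynomial.X
    + Polynomial.C b * Polynomial.X ^ 2 + Polynomial.C c * Polynomial.X ^ 3) ρ
  have hXs := summable_tsum_coeff_polynomial ((1 - Polynomial.X) ^ 2) ρ
  have hRc : ((1 + Polynomial.C a * Polynomial.X + Polynomial.C b * Polynomial.X ^ 2
      + Polynomial.C c * Polynomial.X ^ 3 : Polynomial ℝ) : PowerSeries ℝ) = R := by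
    simp [hR]
  have hXc : (((1 - Polynomial.X) ^ 2 : Polynomial ℝ) : PowerSeries ℝ) = (1 - X) ^ 2 := by
    simp
  rw [hRc] at hRs
  rw [hXc] at hXs
  have hGG := summable_tsum_coeff_mul hGs hGs
  have hGGR := (summable_tsum_coeff_mul hGG.1 hRs.1).2
  rw [← sq G, hGR, hXs.2, sq G, hGG.2, hRs.2, ← hγ] at hGGR
  simp only [Polynomial.eval_add, Polynomial.eval_mul, Polynomial.eval_C, Polynomial.eval_X,
    Polynomial.eval_pow, Polynomial.eval_one, Polynomial.eval_sub] at hGGR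
  have hval : 1 + a * ρ + b * ρ ^ 2 + c * ρ ^ 3 = 4 * (1 - 3 * ρ + 2 * ρ ^ 2 - ρ ^ 3) := by
    rw [ha, hb, hc]
    linear_combination (1 + (t * ρ + 1 - 4 * ρ) + (t * ρ) ^ 2 + t * ρ + 1
      - 4 * ρ * (t * ρ + 1) + 4 * ρ ^ 2) * htρ
  have hpos : 0 < 1 - 3 * ρ + 2 * ρ ^ 2 - ρ ^ 3 := by
    by_contra! hneg
    have h1 : (1 - ρ) ^ 2 ≤ 0 := by
      rw [hGGR, hval]
      exact mul_nonpos_of_nonneg_of_nonpos (mul_self_nonneg γ) (by linarith)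
    nlinarith
  have hγv : γ = (1 - ρ) / (2 * √(1 - 3 * ρ + 2 * ρ ^ 2 - ρ ^ 3)) := by
    have hs := Real.sqrt_pos.mpr hpos
    rw [eq_div_iff (by positivity)]
    refine (pow_left_inj₀ (by positivity) (by linarith) two_ne_zero).mp ?_
    rw [hGGR, hval, mul_pow, mul_pow, Real.sq_sqrt hpos.le]
    ring
  rwa [← hγv]

theorem theorem2p12 :
    (∃! η : ℕ → ℤ, HasCarolinaGF η) ∧
    (∀ η : ℕ → ℤ, HasCarolinaGF η → ∀ n : ℕ, 1 ≤ n →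
      degNoninj (carolina : Composition n → Composition n) = (η n : ℝ) / 2 ^ (n - 1)) ∧
    (∃ ρ : ℝ,
      IsLeast {x : ℝ | 0 < x ∧ 1 - 4 * x + 4 * x ^ 2 - 4 * x ^ 3 + 4 * x ^ 4 = 0} ρ ∧
      |ρ - 0.33933| < 0.000005 ∧
      Asymptotics.IsEquivalent Filter.atTop
        (fun n : ℕ => degNoninj (carolina : Composition n → Composition n))
        (fun n : ℕ => (1 - ρ) / Real.sqrt (Real.pi * (1 - 3 * ρ + 2 * ρ ^ 2 - ρ ^ 3) * n)
          * (1 / (2 * ρ)) ^ n)) := by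
  refine ⟨⟨_, hasCarolinaGF_carolinaPairs, fun η h => funext h.eq_carolinaPairs⟩, ?_, ?_⟩
  · intro η hη n hn
    rw [degNoninj_carolina hn, hη.eq_carolinaPairs n, Int.cast_natCast]
  · obtain ⟨ρ, hρ, hρ'⟩ := exists_carolina_root
    refine ⟨ρ, hρ, hρ', ?_⟩
    have h1 : 0.339 < ρ := by linarith [(abs_lt.mp hρ').1]
    have h2 : ρ < 0.34 := by linarith [(abs_lt.mp hρ').2]
    have hρ0 : 0 < ρ := hρ.1.1
    have hlim := (tendsto_carolinaPairs h1 h2 hρ.1.2).mul tendsto_invSqrtCoeff_mul_sqrt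
    have hpos : 0 < 1 - 3 * ρ + 2 * ρ ^ 2 - ρ ^ 3 := by nlinarith [sq_nonneg ρ]
    set c := 1 - 3 * ρ + 2 * ρ ^ 2 - ρ ^ 3
    have hs := Real.sqrt_pos.mpr hpos
    have hρ3 : (1 - ρ) ≠ 0 := by linarith
    refine Asymptotics.isEquivalent_of_tendsto_one ?_
    have hlim' := hlim.mul_const (2 * √c / (1 - ρ))
    have he : (1 - ρ) / (2 * √c) * 1 * (2 * √c / (1 - ρ)) = 1 := by field_simp
    rw [he] at hlim'
    refine hlim'.congr' ?_
    filter_upwards [eventually_ge_atTop 1] with n hn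
    have hn' : (0 : ℝ) < n := by exact_mod_cast hn
    have hb := invSqrtCoeff_pos n
    have hpn : 0 < √(Real.pi * n) := Real.sqrt_pos.mpr (by positivity)
    have hsq : √(Real.pi * c * n) = √(Real.pi * n) * √c := by
      rw [← Real.sqrt_mul (by positivity)]
      congr 1
      ring
    -- This factor `2` cancels the one in `γ = (1 - ρ) / (2√c)`.
    have h2n : (2 : ℝ) ^ n = 2 * 2 ^ (n - 1) := by
      rw [← pow_succ', Nat.sub_add_cancel hn]
    rw [Pi.div_apply, degNoninj_carolina hn, hsq, div_pow, mul_pow, h2n, one_pow]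
    field_simp
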